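/- Let $f\colon U'\to U$ be a generalized polynomial-like map: $U\subset\mathbb C$ is open and conformally isomorphic to the unit disk $\mathbb D$, $U'=U_1\cup\dots\cup U_N$ is a disjoint union of open sets $U_i$ conformally isomorphic to $\mathbb D$, $\overline{U'}$ is a compact subset of $U$, and $f$ is proper and holomorphic. Let $K_f=\{z\in U' : f^n(z)\in U' \text{ for all } n\ge 0\}$ and $J_f=\partial K_f$. Let $d=\sum_i\deg(f|_{U_i}\colon U_i\to U)$, and assume that $d>1$ and that $K_f=J_f$ is a Cantor set containing all critical points of $f$. Let $w\in U\setminus U'$, and let $\phi\colon\mathbb D\to U\setminus J_f$ be a holomorphic universal covering with $\phi(0)=w$ and group of deck transformations $\Gamma$. By a system of lifts we mean holomorphic maps $g_0,\dots,g_{d-1}\colon\mathbb D\to\mathbb D$ with $\phi\circ g_j(\mathbb D)\subset U'$ and $f\circ\phi\circ g_j=\phi$ such that $\phi(g_0(0)),\dots,\phi(g_{d-1}(0))$ are the $d$ distinct preimages of $w$ under $f$. For a system of lifts, by a good family we mean a choice, for every $k\ge1$ and every block $\epsilon^k=(\epsilon_1,\dots,\epsilon_k)\in\{0,\dots,d-1\}^k$,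 of $\gamma^{\epsilon^k}_1,\dots,\gamma^{\epsilon^k}_k\in\Gamma$ such that the sets $$V_{\epsilon^k}=\gamma^{\epsilon^k}_1\circ g_{\epsilon_1}\circ\dots\circ\gamma^{\epsilon^k}_k\circ g_{\epsilon_k}(\mathbb D)$$ satisfy: (1) $V_{\epsilon_1\dots\epsilon_k}\subset V_{\epsilon_1\dots\epsilon_{k-1}}$ for $k\ge2$; (2) $\gamma_l^{\epsilon_1\dots\epsilon_k}=\gamma_{l-1}^{\epsilon_2\dots\epsilon_k}$ for $2\le l\le k$; (3) $\phi(V_{\epsilon^k})=\phi(V_{\hat\epsilon^k})$ implies $V_{\epsilon^k}=V_{\hat\epsilon^k}$ for all $k\ge1$ and all blocks $\epsilon^k,\hat\epsilon^k$ of length $k$. Systems of lifts exist, and every system of lifts has a good family. For every system of lifts and every good family, the set $\bigcap_{k\ge1}\overline{\phi(V_{\epsilon_1\dots\epsilon_k})}$ consists, for each $\epsilon\in\Sigma_d=\{0,\dots,d-1\}^{\mathbb N}$, of a single point $\pi(\epsilon)$ of $J_f$, and the resulting map $\pi\colon\Sigma_d\to J_f$ has the following property: if $z\in J_f$ is a point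 whose forward orbit $(f^n(z))_{n\ge0}$ contains no critical point of $f$, then $$\#\pi^{-1}(z)=1.$$ -/

import Mathlib

open Set

/-- The open unit disk. -/
def unitDisk : Set ℂ := Metric.ball (0 : ℂ) 1

/-- `A ⊆ ℂ` is open and conformally isomorphic to the unit disk. -/
def IsConformalDisk (A : Set ℂ) : Prop :=
  IsOpen A ∧ ∃ ψ : ℂ → ℂ, DifferentiableOn ℂ ψ unitDisk ∧ BijOn ψ unitDisk A

/-- `f : U' → U` is a generalized polynomial-like map, where `U' = D 0 ∪ ... ∪ D (N - 1)`.
The function `f` is total for convenience; only its values on `U'` matter. -/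
structure IsGenPolyLike (f : ℂ → ℂ) (U U' : Set ℂ) {N : ℕ} (D : Fin N → Set ℂ) : Prop where
  disk : IsConformalDisk U
  disk_component : ∀ i, IsConformalDisk (D i)
  disjoint : ∀ i j, i ≠ j → Disjoint (D i) (D j)
  union : U' = ⋃ i, D i
  compact_closure : IsCompact (closure U')
  closure_subset : closure U' ⊆ U
  holo : DifferentiableOn ℂ f U'
  mapsTo : MapsTo f U' U
  proper : IsProperMap (mapsTo.restrict f U' U)

/-- `f : A → B` has degree `m`: every point of `B` has exactly `m` preimages in `A`,
counted with multiplicity. -/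
def HasDegree (f : ℂ → ℂ) (A B : Set ℂ) (m : ℕ) : Prop :=
  ∀ v ∈ B, (A ∩ f ⁻¹' {v}).Finite ∧
    ∑ᶠ z ∈ A ∩ f ⁻¹' {v}, analyticOrderNatAt (fun x => f x - v) z = m

/-- The filled-in Julia set of `f : U' → U`: the points all of whose iterates are
defined and stay in `U'`. -/
def filledJulia (f : ℂ → ℂ) (U' : Set ℂ) : Set ℂ := {z | ∀ n : ℕ, f^[n] z ∈ U'}

/-- The Julia set of `f : U' → U`. -/
def julia (f : ℂ → ℂ) (U' : Set ℂ) : Set ℂ := frontier (filledJulia f U')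

/-- A Cantor set: homeomorphic to the product `{0, 1} ^ ℕ`. -/
def IsCantorSet (K : Set ℂ) : Prop := Nonempty (K ≃ₜ (ℕ → Bool))

/-- `φ` restricts to a holomorphic covering map of the unit disk onto `Y`;
as the disk is simply connected, it is a universal covering. -/
structure IsDiskUniversalCover (φ : ℂ → ℂ) (Y : Set ℂ) : Prop where
  holo : DifferentiableOn ℂ φ unitDisk
  mapsTo : MapsTo φ unitDisk Y
  surjOn : SurjOn φ unitDisk Y
  covering : IsCoveringMap (mapsTo.restrict φ unitDisk Y)

/-- `γ` is (on the unit disk) a deck transformation of `φ`. -/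
structure IsDeck (φ γ : ℂ → ℂ) : Prop where
  holo : DifferentiableOn ℂ γ unitDisk
  bijOn : BijOn γ unitDisk unitDisk
  comp_eq : ∀ z ∈ unitDisk, φ (γ z) = φ z

/-- `g 0, ..., g (d - 1)` are holomorphic self-maps of the disk with `f ∘ φ ∘ g j = φ` such that
the points `φ (g j 0)` enumerate without repetition the preimages of `w = φ 0` under
`f : U' → U`. -/
structure IsLiftSystem (f : ℂ → ℂ) (U' : Set ℂ) (φ : ℂ → ℂ) {d : ℕ}
    (g : Fin d → ℂ → ℂ) : Prop where
  holo : ∀ j, DifferentiableOn ℂ (g j) unitDisk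
  mapsTo : ∀ j, MapsTo (g j) unitDisk unitDisk
  mem_domain : ∀ j, ∀ z ∈ unitDisk, φ (g j z) ∈ U'
  lift : ∀ j, ∀ z ∈ unitDisk, f (φ (g j z)) = φ z
  base : BijOn (fun j => φ (g j 0)) univ (U' ∩ f ⁻¹' {φ 0})

/-- For a block `e = (e 0, ..., e (k - 1))` and maps `c 0, ..., c (k - 1)`, the composition
`c 0 ∘ g (e 0) ∘ c 1 ∘ g (e 1) ∘ ... ∘ c (k - 1) ∘ g (e (k - 1))`. -/
def blockMap {d : ℕ} (g : Fin d → ℂ → ℂ) :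
    (k : ℕ) → (Fin k → Fin d) → (Fin k → ℂ → ℂ) → ℂ → ℂ
  | 0, _, _ => id
  | k + 1, e, c => c 0 ∘ g (e 0) ∘ blockMap g k (Fin.tail e) (Fin.tail c)

/-- The set `V_e`, the image of the disk under the composition attached to the block `e`. Here
`γ k e l` is the map in position `l` (counted from `0`) belonging to the block `e` of length `k`. -/
def blockSet {d : ℕ} (g : Fin d → ℂ → ℂ) (γ : (k : ℕ) → (Fin k → Fin d) → Fin k → ℂ → ℂ)
    (k : ℕ) (e : Fin k → Fin d) : Set ℂ :=
  blockMap g k e (γ k e) '' unitDisk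

/-- A family of deck transformations for which the sets `V_e` are nested (`Fin.init` forgets the
last symbol), compatible with the shift (`Fin.tail` forgets the first symbol), and merged. -/
structure IsGoodFamily (φ : ℂ → ℂ) {d : ℕ} (g : Fin d → ℂ → ℂ)
    (γ : (k : ℕ) → (Fin k → Fin d) → Fin k → ℂ → ℂ) : Prop where
  deck : ∀ (k : ℕ) (e : Fin k → Fin d) (l : Fin k), IsDeck φ (γ k e l)
  nested : ∀ k : ℕ, 1 ≤ k → ∀ e : Fin (k + 1) → Fin d,
    blockSet g γ (k + 1) e ⊆ blockSet g γ k (Fin.init e)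
  shift : ∀ k : ℕ, 1 ≤ k → ∀ (e : Fin (k + 1) → Fin d) (l : Fin k),
    EqOn (γ (k + 1) e l.succ) (γ k (Fin.tail e) l) unitDisk
  merged : ∀ k : ℕ, 1 ≤ k → ∀ e e' : Fin k → Fin d,
    φ '' blockSet g γ k e = φ '' blockSet g γ k e' → blockSet g γ k e = blockSet g γ k e'

/-- The intersection over `k ≥ 1` of the closures of `φ (V_(ε_1 ... ε_k))`; the first symbol of
the sequence is `ε 0`. The coding map `π` sends `ε` to the unique point of this set. -/
def codingSet (φ : ℂ → ℂ) {d : ℕ} (g : Fin d → ℂ → ℂ)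
    (γ : (k : ℕ) → (Fin k → Fin d) → Fin k → ℂ → ℂ) (ε : ℕ → Fin d) : Set ℂ :=
  ⋂ (k : ℕ) (_ : 1 ≤ k), closure (φ '' blockSet g γ k (fun i => ε i))

open Filter Topology

/-! Write `J` for the Julia set and `Y_k` for the set of points of `U'` whose `k`-th iterate lies in
`U \ J` (`preimageLevel`, with `Y_0 = U \ J`). All critical points lie in `J`, so `f` is a covering
over `U \ J`. The composition `B` attached to a block of length `k` satisfies `f^[k] ∘ φ ∘ B = φ`;
path lifting then shows that `φ(V_e)` is a path component of `Y_k` and `V_e` is a path component of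
`φ⁻¹(Y_k)` (`image_map_blockMap_eq`, `image_blockMap_eq`). Good families are built by choosing which
component upstairs represents each component downstairs (`IsGoodLevel.exists_succ`).

The coding set of a sequence is a nested intersection of compact connected sets, hence connected,
and properness of `f` puts it inside `J`. Since `J` is totally disconnected, it is one point. As `J`
has empty interior, block images of each length accumulate at every point of `J`, and compactness of
the sequence space gives a code.

Uniqueness rests on a fact of plane topology: a Cantor set does not separate the plane locally
(`exists_nhds_forall_joinedIn_diff`). Two blocks of equal length whose image closures contain the
same `z ∈ J` therefore have the same image. If `f` is injective near `z`, this determines the first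
symbol: merging makes the tails agree upstairs, and two distinct lifts `φ ∘ g i`, `φ ∘ g j` of `φ`
through `f` never take the same value at a point (`head_eq_of_mem_codingSet`). Applying `f` shifts
the code, so induction along a noncritical orbit determines all symbols. -/

theorem isPreconnected_unitDisk : IsPreconnected unitDisk :=
  (convex_ball (0 : ℂ) 1).isPreconnected

theorem isPathConnected_unitDisk : IsPathConnected unitDisk :=
  (convex_ball (0 : ℂ) 1).isPathConnected ⟨0, by simp⟩

theorem zero_mem_unitDisk : (0 : ℂ) ∈ unitDisk := by simp [unitDisk]

theorem isOpen_unitDisk : IsOpen unitDisk := Metric.isOpen_ball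

instance : LocallyPathConnectedSpace unitDisk := isOpen_unitDisk.locallyPathConnectedSpace

instance : SimplyConnectedSpace unitDisk := by
  have := (convex_ball (0 : ℂ) 1).contractibleSpace ⟨0, zero_mem_unitDisk⟩
  have : ContractibleSpace unitDisk := this
  infer_instance

/-! ### Plane topology: Cantor sets do not separate locally. -/

/-- A disjoint union of two closed subsets of the plane does not separate two points if neither
of them does. -/
theorem joinedIn_compl_union_of_disjoint {X Y S T : Set ℂ} (hX : IsClosed X) (hY : IsClosed Y)
    (hXY : Disjoint X Y) {p q : ℂ} (hS : IsPreconnected S) (hSX : S ⊆ Xᶜ) (hpS : p ∈ S)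
    (hqS : q ∈ S) (hT : IsPreconnected T) (hTY : T ⊆ Yᶜ) (hpT : p ∈ T) (hqT : q ∈ T) :
    JoinedIn (X ∪ Y)ᶜ p q := by
  classical
  by_contra hpq
  have hΩ : IsOpen (X ∪ Y)ᶜ := (hX.union hY).isOpen_compl
  set P := pathComponentIn (X ∪ Y)ᶜ p with hP
  have hPo : IsOpen P := hΩ.pathComponentIn p
  have hpP : p ∈ P := mem_pathComponentIn_self (by
    rintro (h | h)
    · exact hSX hpS h
    · exact hTY hpT h)
  have hqP : q ∉ P := hpq
  have hfr : frontier P ⊆ X ∪ Y := by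
    intro x hx
    by_contra hxΩ
    have hxP : x ∉ P := by
      rw [hPo.frontier_eq] at hx
      exact hx.2
    have hn : pathComponentIn (X ∪ Y)ᶜ x ∈ 𝓝 x :=
      (hΩ.pathComponentIn x).mem_nhds (mem_pathComponentIn_self hxΩ)
    obtain ⟨y, hyx, hyP⟩ := mem_closure_iff_nhds.1 (frontier_subset_closure hx) _ hn
    exact hxP (JoinedIn.trans hyP (JoinedIn.symm hyx))
  obtain ⟨l, hl0, hl1, -⟩ := exists_continuous_zero_one_of_isClosed hX hY hXY
  -- The map `exp(2πi l)` equals `1` on `X ∪ Y`, which contains the frontier of `P`, so it can be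
  -- glued to the constant `1` outside `P`. It lifts to a real function `θ` because the plane is
  -- simply connected.
  let u : C(ℂ, Circle) := ⟨P.piecewise (fun z => Circle.exp (2 * Real.pi * l z)) 1, by
    refine Continuous.piecewise (fun a ha => ?_) (by fun_prop) continuous_const
    rcases hfr ha with h | h
    · simp [hl0 h]
    · simp [hl1 h]⟩
  have huP : ∀ z ∈ P, u z = Circle.exp (2 * Real.pi * l z) := fun z hz =>
    Set.piecewise_eq_of_mem P (fun z => Circle.exp (2 * Real.pi * l z)) 1 hz
  have huP' : ∀ z ∉ P, u z = 1 := fun z hz => Set.piecewise_eq_of_notMem P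
    (fun z => Circle.exp (2 * Real.pi * l z)) 1 hz
  obtain ⟨θ, ⟨hθp, hθ⟩, -⟩ := Circle.isCoveringMap_exp.existsUnique_continuousMap_lifts u p
    (2 * Real.pi * l p) (huP p hpP).symm
  have hθ' : ∀ z, Circle.exp (θ z) = u z := fun z => congrFun hθ z
  -- On a connected set from `p` to `q` that meets only one of `X`, `Y`, the lift `θ` is explicit:
  -- `2πl` on `P` and the constant `2πc` off `P`. Using `T` (`c = 0`) and `S` (`c = 1`) gives two
  -- different values for `θ q`.
  have key : ∀ (A : Set ℂ) (c : ℝ), Circle.exp (2 * Real.pi * c) = 1 → IsPreconnected A →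
      (∀ z ∈ A, z ∈ X ∪ Y → l z = c) → p ∈ A → q ∈ A → θ q = 2 * Real.pi * c := by
    intro A c hc hA hAc hpA hqA
    have hv : ContinuousOn (P.piecewise (fun z => 2 * Real.pi * l z) fun _ => 2 * Real.pi * c) A := by
      refine ContinuousOn.piecewise (fun a ha => ?_) (by fun_prop) continuousOn_const
      rw [hAc a ha.1 (hfr ha.2)]
    have := Circle.isCoveringMap_exp.eqOn_of_comp_eqOn hA θ.continuous.continuousOn hv
      (fun z hz => by
        by_cases hzP : z ∈ P
        · simp [hθ', huP z hzP, hzP]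
        · simp [hθ', huP' z hzP, hzP, hc]) hpA (by simp [hpP, hθp])
    rw [this hqA]
    simp [hqP]
  have h0 := key T 0 (by simp) hT (fun z hz h => h.elim (fun h => hl0 h)
    (fun h => absurd h (hTY hz))) hpT hqT
  have h1 := key S 1 (by simp) hS (fun z hz h => h.elim (fun h => absurd h (hSX hz))
    (fun h => hl1 h)) hpS hqS
  rw [h0] at h1
  simp at h1

/-- A compact totally disconnected subset of the plane with connected complement in `Z` does not
separate the plane locally. -/
theorem exists_nhds_forall_joinedIn_diff {Z J O : Set ℂ} (hJ : IsCompact J)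
    (hJd : TotallyDisconnectedSpace J) (hZ : IsPreconnected (Z \ J)) (hZo : IsOpen Z) (hJZ : J ⊆ Z)
    (hO : IsOpen O) {z : ℂ} (hz : z ∈ J) (hzO : z ∈ O) :
    ∃ W ∈ 𝓝 z, ∀ p ∈ W \ J, ∀ q ∈ W \ J, JoinedIn (O \ J) p q := by
  have : CompactSpace J := isCompact_iff_compactSpace.1 hJ
  -- Apply the separation lemma with `X` the clopen piece `V` and `Y` the rest of `J` together with
  -- the complement of `O`. Then `Z \ J` avoids `X`, a small ball around `z` avoids `Y`, and the
  -- complement of `X ∪ Y` is `O \ J`.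
  obtain ⟨V, hV, hzV, hVO⟩ := compact_exists_isClopen_in_isOpen (x := (⟨z, hz⟩ : J))
    (hO.preimage continuous_subtype_val) hzO
  have hX : IsClosed (Subtype.val '' V : Set ℂ) :=
    hJ.isClosed.isClosedMap_subtype_val _ hV.1
  have hY' : IsClosed (Subtype.val '' Vᶜ : Set ℂ) :=
    hJ.isClosed.isClosedMap_subtype_val _ hV.compl.1
  have hY : IsClosed (Subtype.val '' Vᶜ ∪ Oᶜ : Set ℂ) := hY'.union hO.isClosed_compl
  have hXY : Disjoint (Subtype.val '' V : Set ℂ) (Subtype.val '' Vᶜ ∪ Oᶜ) := by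
    rw [Set.disjoint_left]
    rintro _ ⟨x, hx, rfl⟩ (⟨y, hy, hyx⟩ | h)
    · rw [Subtype.val_injective hyx] at hy
      exact hy hx
    · exact h (hVO hx)
  have hXYe : (Subtype.val '' V ∪ (Subtype.val '' Vᶜ ∪ Oᶜ) : Set ℂ)ᶜ = O \ J := by
    rw [← union_assoc, ← image_union, union_compl_self, image_univ, Subtype.range_coe]
    ext x
    simp [and_comm]
  have hzY : (Subtype.val '' Vᶜ ∪ Oᶜ : Set ℂ)ᶜ ∩ Z ∈ 𝓝 z :=
    (hY.isOpen_compl.inter hZo).mem_nhds ⟨Set.disjoint_left.1 hXY ⟨_, hzV, rfl⟩, hJZ hz⟩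
  obtain ⟨r, hr, hrY⟩ := Metric.mem_nhds_iff.1 hzY
  refine ⟨_, Metric.ball_mem_nhds z hr, fun p hp q hq => ?_⟩
  rw [← hXYe]
  refine joinedIn_compl_union_of_disjoint hX hY hXY hZ ?_ ⟨(hrY hp.1).2, hp.2⟩
    ⟨(hrY hq.1).2, hq.2⟩ (convex_ball z r).isPreconnected (fun x hx => (hrY hx).1) hp.1 hq.1
  rintro x hx ⟨y, -, rfl⟩
  exact hx.2 y.2

/-! ### Local injectivity, uniqueness and holomorphy of lifts. -/

/-- Every point of `E` has a neighbourhood on whose trace in `E` the map `p` is injective. -/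
def LocallyInjOn (p : ℂ → ℂ) (E : Set ℂ) : Prop := ∀ x ∈ E, ∃ V ∈ 𝓝 x, InjOn p (V ∩ E)

/-- Uniqueness of lifts: the set where the two maps agree is open by local injectivity and closed by
the Hausdorff property. -/
theorem LocallyInjOn.eqOn {p : ℂ → ℂ} {E : Set ℂ} (hp : LocallyInjOn p E) {A : Type*}
    [TopologicalSpace A] {S : Set A} (hS : IsPreconnected S) {g₁ g₂ : A → ℂ}
    (h₁ : ContinuousOn g₁ S) (h₂ : ContinuousOn g₂ S) (m₁ : MapsTo g₁ S E) (m₂ : MapsTo g₂ S E)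
    (he : ∀ a ∈ S, p (g₁ a) = p (g₂ a)) {a : A} (ha : a ∈ S) (hga : g₁ a = g₂ a) :
    EqOn g₁ g₂ S := by
  have hinj : IsLocallyInjective fun x : E => p x := by
    rw [isLocallyInjective_iff_nhds]
    rintro ⟨x, hx⟩
    obtain ⟨V, hV, hVi⟩ := hp x hx
    exact ⟨Subtype.val ⁻¹' V, continuous_subtype_val.continuousAt.preimage_mem_nhds hV,
      fun y hy z hz hyz => Subtype.ext (hVi ⟨hy, y.2⟩ ⟨hz, z.2⟩ hyz)⟩
  have := isPreconnected_iff_preconnectedSpace.1 hS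
  have h := (T2Space.isSeparatedMap fun x : E => p x).eq_of_comp_eq hinj
    (h₁.mapsToRestrict m₁) (h₂.mapsToRestrict m₂) (funext fun b => he b b.2) ⟨a, ha⟩
    (Subtype.ext hga)
  exact fun b hb => congrArg Subtype.val (congrFun h ⟨b, hb⟩)

theorem LocallyInjOn.comp {p q : ℂ → ℂ} {E F : Set ℂ} (hq : LocallyInjOn q F)
    (hp : LocallyInjOn p E) (hc : ContinuousOn p E) (hm : MapsTo p E F) :
    LocallyInjOn (q ∘ p) E := by
  intro x hx
  obtain ⟨V, hV, hVi⟩ := hq _ (hm hx)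
  obtain ⟨W, hW, hWi⟩ := hp x hx
  obtain ⟨W', hW', hW'V⟩ := mem_nhdsWithin_iff_exists_mem_nhds_inter.1 (hc x hx hV)
  refine ⟨W ∩ W', inter_mem hW hW', fun a ha b hb hab => hWi ⟨ha.1.1, ha.2⟩ ⟨hb.1.1, hb.2⟩ ?_⟩
  exact hVi ⟨hW'V ⟨ha.1.2, ha.2⟩, hm ha.2⟩ ⟨hW'V ⟨hb.1.2, hb.2⟩, hm hb.2⟩ hab

theorem LocallyInjOn.mono {p : ℂ → ℂ} {E F : Set ℂ} (hp : LocallyInjOn p F) (h : E ⊆ F) :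
    LocallyInjOn p E := fun x hx =>
  let ⟨V, hV, hVi⟩ := hp x (h hx)
  ⟨V, hV, hVi.mono (inter_subset_inter_right _ h)⟩

theorem exists_nhds_injOn_of_deriv_ne_zero {f : ℂ → ℂ} {x : ℂ} (hf : AnalyticAt ℂ f x)
    (h : deriv f x ≠ 0) : ∃ V ∈ 𝓝 x, InjOn f V := by
  have hs := hf.hasStrictDerivAt.hasStrictFDerivAt_equiv h
  exact ⟨_, (hs.toOpenPartialHomeomorph f).open_source.mem_nhds
    hs.mem_toOpenPartialHomeomorph_source, (hs.toOpenPartialHomeomorph f).injOn⟩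

theorem locallyInjOn_of_deriv_ne_zero {f : ℂ → ℂ} {E : Set ℂ} (hf : ∀ x ∈ E, AnalyticAt ℂ f x)
    (h : ∀ x ∈ E, deriv f x ≠ 0) : LocallyInjOn f E := fun x hx =>
  let ⟨V, hV, hVi⟩ := exists_nhds_injOn_of_deriv_ne_zero (hf x hx) (h x hx)
  ⟨V, hV, hVi.mono inter_subset_left⟩

/-- A continuous local lift of a holomorphic map through a holomorphic locally injective map is
holomorphic. -/
theorem differentiableAt_of_comp_eq {φ g h : ℂ → ℂ} {z : ℂ} {V : Set ℂ}
    (hφ : AnalyticAt ℂ φ (g z)) (hV : V ∈ 𝓝 (g z)) (hVi : InjOn φ V) (hh : AnalyticAt ℂ h z)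
    (hg : ∀ᶠ y in 𝓝 z, ContinuousAt g y) (hgh : ∀ᶠ y in 𝓝 z, φ (g y) = h y) :
    DifferentiableAt ℂ g z := by
  have hgV : ∀ᶠ y in 𝓝 z, g y ∈ V := hg.self_of_nhds hV
  -- If `h` is locally constant, injectivity of `φ` makes `g` locally constant. Otherwise `g` avoids
  -- the value `g z` on a punctured neighbourhood, hence also the isolated zeros of `deriv φ`; there
  -- `g` is a local inverse of `φ` composed with `h`, and the singularity at `z` is removable.
  rcases hh.eventually_eq_or_eventually_ne (analyticAt_const (v := h z)) with hc | hc
  · have : g =ᶠ[𝓝 z] fun _ => g z := by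
      filter_upwards [hc, hgh, hgV] with y h1 h2 h3
      exact hVi h3 (mem_of_mem_nhds hV) (by rw [h2, h1, hgh.self_of_nhds])
    exact (differentiableAt_const _).congr_of_eventuallyEq this
  · have hnc : ∀ᶠ y in 𝓝[≠] g z, deriv φ y ≠ 0 := by
      rcases hφ.deriv.eventually_eq_zero_or_eventually_ne_zero with h0 | h0
      · exfalso
        obtain ⟨r, hr, hrV⟩ := Metric.mem_nhds_iff.1 (inter_mem (inter_mem h0
          hφ.eventually_analyticAt) hV)
        have hconst : ∀ y ∈ Metric.ball (g z) r, φ y = φ (g z) := fun y hy =>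
          (convex_ball (g z) r).is_const_of_fderivWithin_eq_zero (𝕜 := ℂ)
            (fun x hx => (hrV hx).1.2.differentiableAt.differentiableWithinAt)
            (fun x hx => by
              rw [fderivWithin_of_isOpen Metric.isOpen_ball hx]
              ext
              simpa using (hrV hx).1.1) hy (Metric.mem_ball_self hr)
        have hb : ∀ y ∈ Metric.ball (g z) r, y = g z := fun y hy =>
          hVi (hrV hy).2 (mem_of_mem_nhds hV) (hconst y hy)
        have := hb (g z + (r / 2 : ℝ)) (by simp [abs_of_pos hr, hr])
        simp at this
        exact hr.ne' this
      · exact h0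
    refine (Complex.analyticAt_of_differentiable_on_punctured_nhds_of_continuousAt ?_
      hg.self_of_nhds).differentiableAt
    have hgne : ∀ᶠ y in 𝓝[≠] z, g y ≠ g z := by
      filter_upwards [hc, nhdsWithin_le_nhds hgh] with y h1 h2 h3
      rw [h3, hgh.self_of_nhds] at h2
      exact h1 h2.symm
    have htend : Tendsto g (𝓝[≠] z) (𝓝[≠] g z) :=
      tendsto_nhdsWithin_iff.2 ⟨hg.self_of_nhds.tendsto.mono_left nhdsWithin_le_nhds, hgne⟩
    filter_upwards [htend.eventually hnc, nhdsWithin_le_nhds hg.eventually_nhds,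
      nhdsWithin_le_nhds hgh.eventually_nhds, nhdsWithin_le_nhds hh.eventually_analyticAt,
      nhdsWithin_le_nhds (hg.self_of_nhds.eventually hφ.eventually_analyticAt)]
      with y h1 h2 h3 h4 h5
    have hs := h5.hasStrictDerivAt
    have hc' : ContinuousAt g y := h2.self_of_nhds
    have hl : ∀ᶠ x in 𝓝 y, hs.localInverse φ (deriv φ (g y)) (g y) h1 (h x) = g x := by
      filter_upwards [hc'.eventually (hs.eventually_left_inverse h1), h3] with x hx hx'
      rw [← hx', hx]
    have hd : DifferentiableAt ℂ (hs.localInverse φ (deriv φ (g y)) (g y) h1) (h y) := by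
      rw [← h3.self_of_nhds]
      exact (hs.to_localInverse h1).hasDerivAt.differentiableAt
    exact (hd.comp y h4.differentiableAt).congr_of_eventuallyEq (hl.mono fun x hx => hx.symm)

/-- A separation of the intersection extends to disjoint open sets, whose union contains some `K n`
by compactness; connectedness of `K n` rules the separation out. -/
theorem isPreconnected_iInter_of_antitone {K : ℕ → Set ℂ} (hK : Antitone K)
    (hc : ∀ n, IsCompact (K n)) (hp : ∀ n, IsPreconnected (K n)) : IsPreconnected (⋂ n, K n) := by
  have hcl : IsClosed (⋂ n, K n) := isClosed_iInter fun n => (hc n).isClosed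
  rw [isPreconnected_iff_subset_of_fully_disjoint_closed hcl]
  intro a b ha hb hab hd
  obtain ⟨u, v, hu, hv, hau, hbv, huv⟩ := normal_separation ha hb hd
  obtain ⟨n, hn⟩ := exists_subset_nhds_of_isCompact (V := K) hK.directed_ge hc (U := u ∪ v)
    (fun x hx => (hu.union hv).mem_nhds ((hab hx).imp (fun h => hau h) fun h => hbv h))
  have hsub : (⋂ n, K n) ⊆ K n := iInter_subset _ _
  rcases (hp n).subset_or_subset hu hv huv hn with h | h
  · left
    intro x hx
    exact (hab hx).resolve_right fun hb' => huv.le_bot ⟨h (hsub hx), hbv hb'⟩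
  · right
    intro x hx
    exact (hab hx).resolve_left fun ha' => huv.le_bot ⟨hau ha', h (hsub hx)⟩

/-! ### Lifting through the universal covering. -/

namespace IsDiskUniversalCover

variable {φ : ℂ → ℂ} {Y : Set ℂ}

theorem locallyInjOn (hφ : IsDiskUniversalCover φ Y) : LocallyInjOn φ unitDisk := by
  intro x hx
  obtain ⟨V, hVo, hxV, hVi⟩ := hφ.covering.isLocalHomeomorph.isLocallyInjective ⟨x, hx⟩
  obtain ⟨W, hWo, rfl⟩ := isOpen_induced_iff.1 hVo
  refine ⟨W, hWo.mem_nhds hxV, fun a ha b hb hab => ?_⟩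
  exact congrArg Subtype.val (@hVi ⟨a, ha.2⟩ ha.1 ⟨b, hb.2⟩ hb.1 (Subtype.ext hab))

theorem isPreconnected (hφ : IsDiskUniversalCover φ Y) : IsPreconnected Y := by
  rw [← hφ.surjOn.image_eq_of_mapsTo hφ.mapsTo]
  exact isPreconnected_unitDisk.image _ hφ.holo.continuousOn

theorem exists_lift (hφ : IsDiskUniversalCover φ Y) {h : ℂ → ℂ}
    (hh : DifferentiableOn ℂ h unitDisk) (hm : MapsTo h unitDisk Y) {a e : ℂ} (ha : a ∈ unitDisk)
    (he : e ∈ unitDisk) (hae : φ e = h a) :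
    ∃ g : ℂ → ℂ, DifferentiableOn ℂ g unitDisk ∧ MapsTo g unitDisk unitDisk ∧ g a = e ∧
      ∀ z ∈ unitDisk, φ (g z) = h z := by
  classical
  obtain ⟨F, ⟨hFa, hF⟩, -⟩ := hφ.covering.existsUnique_continuousMap_lifts
    ⟨hm.restrict h unitDisk Y, hh.continuousOn.mapsToRestrict hm⟩ ⟨a, ha⟩ ⟨e, he⟩
    (Subtype.ext hae)
  let g : ℂ → ℂ := fun z => if hz : z ∈ unitDisk then F ⟨z, hz⟩ else 0
  have hg : ∀ z (hz : z ∈ unitDisk), g z = F ⟨z, hz⟩ := fun z hz => dif_pos hz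
  have hgm : MapsTo g unitDisk unitDisk := fun z hz => by rw [hg z hz]; exact (F _).2
  have hgc : ContinuousOn g unitDisk := by
    rw [continuousOn_iff_continuous_domRestrict]
    have : unitDisk.domRestrict g = fun z => (F z : ℂ) := funext fun z => hg z z.2
    rw [this]
    fun_prop
  have hgl : ∀ z ∈ unitDisk, φ (g z) = h z := fun z hz => by
    rw [hg z hz]
    exact congrArg Subtype.val (congrFun hF ⟨z, hz⟩)
  refine ⟨g, fun z hz => ?_, hgm, by rw [hg a ha, hFa], hgl⟩
  obtain ⟨V, hV, hVi⟩ := hφ.locallyInjOn _ (hgm hz)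
  have hD := isOpen_unitDisk.mem_nhds hz
  have hD' := isOpen_unitDisk.mem_nhds (hgm hz)
  refine (differentiableAt_of_comp_eq (hφ.holo.analyticAt hD') (inter_mem hV hD') hVi
    (hh.analyticAt hD) ?_ ?_).differentiableWithinAt
  · filter_upwards [hD] with y hy using hgc.continuousAt (isOpen_unitDisk.mem_nhds hy)
  · filter_upwards [hD] with y hy using hgl y hy

/-- Lift `φ` through itself in both directions, from `q` to `p` and from `p` to `q`; uniqueness of
lifts makes the two maps mutually inverse. -/
theorem exists_deck (hφ : IsDiskUniversalCover φ Y) {p q : ℂ} (hp : p ∈ unitDisk)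
    (hq : q ∈ unitDisk) (hpq : φ p = φ q) : ∃ γ, IsDeck φ γ ∧ γ q = p := by
  obtain ⟨γ, hγd, hγm, hγq, hγ⟩ := hφ.exists_lift hφ.holo hφ.mapsTo hq hp hpq
  obtain ⟨η, hηd, hηm, hηp, hη⟩ := hφ.exists_lift hφ.holo hφ.mapsTo hp hq hpq.symm
  have h1 : EqOn (η ∘ γ) id unitDisk := hφ.locallyInjOn.eqOn isPreconnected_unitDisk
    (hηd.continuousOn.comp hγd.continuousOn hγm) continuousOn_id (hηm.comp hγm) (mapsTo_id _)
    (fun z hz => by simp [hη _ (hγm hz), hγ z hz]) hq (by simp [hγq, hηp])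
  have h2 : EqOn (γ ∘ η) id unitDisk := hφ.locallyInjOn.eqOn isPreconnected_unitDisk
    (hγd.continuousOn.comp hηd.continuousOn hηm) continuousOn_id (hγm.comp hηm) (mapsTo_id _)
    (fun z hz => by simp [hγ _ (hηm hz), hη z hz]) hp (by simp [hγq, hηp])
  exact ⟨γ, ⟨hγd, InvOn.bijOn ⟨h1, h2⟩ hγm hηm, hγ⟩, hγq⟩

/-- If a covering `φ` of the disk factors as `F ∘ B` with `F` locally injective on `Z`, then the
image of `B` is a path component of `Z`. -/
theorem image_eq_pathComponentIn (hφ : IsDiskUniversalCover φ Y) {F B : ℂ → ℂ} {Z : Set ℂ}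
    (hFc : ContinuousOn F Z) (hFm : MapsTo F Z Y) (hFi : LocallyInjOn F Z)
    (hBc : ContinuousOn B unitDisk) (hBm : MapsTo B unitDisk Z)
    (hFB : ∀ u ∈ unitDisk, F (B u) = φ u) {y : ℂ} (hy : y ∈ B '' unitDisk) :
    B '' unitDisk = pathComponentIn Z y := by
  refine Subset.antisymm ((isPathConnected_unitDisk.image' hBc).subset_pathComponentIn hy
    hBm.image_subset) fun y' hy' => ?_
  obtain ⟨u, hu, rfl⟩ := hy
  have hj : JoinedIn Z (B u) y' := hy'
  have hγZ : ∀ t, hj.somePath t ∈ Z := hj.somePath_mem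
  -- Push the path down by `F` and lift it through `φ` to a path `Γ` starting at `u`. Then `B ∘ Γ`
  -- and the original path lie over the same path under `F` and start at the same point, so they
  -- coincide.
  have hc : Continuous fun t => (⟨F (hj.somePath t), hFm (hγZ t)⟩ : Y) :=
    (hFc.comp_continuous hj.somePath.continuous hγZ).subtype_mk _
  obtain ⟨Γ, hΓ, hΓ0⟩ := hφ.covering.exists_path_lifts ⟨_, hc⟩ ⟨u, hu⟩
    (Subtype.ext (by simp [hFB u hu]))
  have hBΓ : ∀ t, B (Γ t) ∈ Z := fun t => hBm (Γ t).2
  have h := hFi.eqOn (isPreconnected_univ (α := unitInterval))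
    (hBc.comp_continuous (continuous_subtype_val.comp Γ.continuous)
      fun t => (Γ t).2).continuousOn hj.somePath.continuous.continuousOn
    (fun t _ => hBΓ t) (fun t _ => hγZ t)
    (fun t _ => by
      have := congrArg Subtype.val (congrFun hΓ t)
      simpa [hFB _ (Γ t).2] using this) (mem_univ 0) (by simp [hΓ0])
  refine ⟨Γ 1, (Γ 1).2, ?_⟩
  simpa using h (mem_univ 1)

end IsDiskUniversalCover

namespace IsDeck

variable {φ γ : ℂ → ℂ}

theorem mapsTo (h : IsDeck φ γ) : MapsTo γ unitDisk unitDisk := h.bijOn.mapsTo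

end IsDeck

/-! ### The covering `f` over `U \ J` and lift systems. -/

/-- The topological data used for the coding: a proper holomorphic map `f : U' → U` with finite
fibres and a compact totally disconnected invariant set `J` of empty interior which contains the
critical points and consists of the points that never leave `U'`. -/
structure IsCantorSystem (f : ℂ → ℂ) (U U' J : Set ℂ) : Prop where
  isOpen_range : IsOpen U
  isOpen_domain : IsOpen U'
  compact_closure : IsCompact (closure U')
  closure_subset : closure U' ⊆ U
  holo : DifferentiableOn ℂ f U'
  mapsTo : MapsTo f U' U
  proper : IsProperMap (mapsTo.restrict f U' U)
  finite_fiber : ∀ v ∈ U, (U' ∩ f ⁻¹' {v}).Finite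
  mem_iff : ∀ z, z ∈ J ↔ ∀ n : ℕ, f^[n] z ∈ U'
  compact : IsCompact J
  totallyDisconnected : TotallyDisconnectedSpace J
  interior_eq : interior J = ∅
  deriv_ne_zero : ∀ x ∈ U', x ∉ J → deriv f x ≠ 0

namespace IsCantorSystem

variable {f : ℂ → ℂ} {U U' J : Set ℂ}

theorem subset_domain (h : IsCantorSystem f U U' J) : J ⊆ U' := fun z hz => (h.mem_iff z).1 hz 0

theorem domain_subset (h : IsCantorSystem f U U' J) : U' ⊆ U :=
  subset_closure.trans h.closure_subset

theorem mem_iff_map_mem (h : IsCantorSystem f U U' J) {z : ℂ} (hz : z ∈ U') :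
    f z ∈ J ↔ z ∈ J := by
  rw [h.mem_iff, h.mem_iff]
  refine ⟨fun hn n => ?_, fun hn n => hn (n + 1)⟩
  cases n with
  | zero => exact hz
  | succ n => exact hn n

theorem analyticAt (h : IsCantorSystem f U U' J) {z : ℂ} (hz : z ∈ U') : AnalyticAt ℂ f z :=
  h.holo.analyticAt (h.isOpen_domain.mem_nhds hz)

theorem locallyInjOn (h : IsCantorSystem f U U' J) : LocallyInjOn f (U' \ J) :=
  locallyInjOn_of_deriv_ne_zero (fun _ hx => h.analyticAt hx.1)
    fun x hx => h.deriv_ne_zero x hx.1 hx.2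

theorem isLocalHomeomorphOn (h : IsCantorSystem f U U' J) : IsLocalHomeomorphOn f (U' \ J) := by
  refine IsLocalHomeomorphOn.mk _ _ fun x hx => ?_
  have hs := (h.analyticAt hx.1).hasStrictDerivAt.hasStrictFDerivAt_equiv
    (h.deriv_ne_zero x hx.1 hx.2)
  exact ⟨hs.toOpenPartialHomeomorph f, hs.mem_toOpenPartialHomeomorph_source, fun _ _ => rfl⟩

/-- Over `U \ J` all preimages are noncritical, so `f` is a local homeomorphism there; being closed
with finite fibres, it is a covering. -/
theorem isCoveringMapOn (h : IsCantorSystem f U U' J) :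
    IsCoveringMapOn (h.mapsTo.restrict f U' U) {y | (y : ℂ) ∉ J} := by
  refine h.proper.isClosedMap.isCoveringMapOn_of_isLocalHomeomorphOn (fun x _ => ?_) ?_
  · refine Finite.of_finite_image (f := Subtype.val) ((h.finite_fiber x x.2).subset ?_)
      Subtype.val_injective.injOn
    rintro _ ⟨e, he, rfl⟩
    exact ⟨e.2, congrArg Subtype.val he⟩
  · refine IsLocalHomeomorphOn.of_comp_left (g := Subtype.val) ?_
      (h.isOpen_range.isOpenEmbedding_subtypeVal.isLocalHomeomorph.isLocalHomeomorphOn.mono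
        (subset_univ _)) (fun e _ => h.proper.continuous.continuousAt)
    exact h.isLocalHomeomorphOn.comp (f := (Subtype.val : U' → ℂ))
      (h.isOpen_domain.isOpenEmbedding_subtypeVal.isLocalHomeomorph.isLocalHomeomorphOn.mono
        (subset_univ _)) fun e he => ⟨e.2, fun hJ => he ((h.mem_iff_map_mem e.2).2 hJ)⟩

theorem exists_lift (h : IsCantorSystem f U U' J) {φ : ℂ → ℂ}
    (hφ : IsDiskUniversalCover φ (U \ J)) {a x : ℂ} (ha : a ∈ unitDisk) (hx : x ∈ U')
    (hxa : f x = φ a) :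
    ∃ g : ℂ → ℂ, DifferentiableOn ℂ g unitDisk ∧ MapsTo g unitDisk (U' \ J) ∧ g a = x ∧
      ∀ z ∈ unitDisk, f (g z) = φ z := by
  classical
  have hm : MapsTo φ unitDisk U := fun z hz => (hφ.mapsTo hz).1
  obtain ⟨F, ⟨hFa, hF⟩, -⟩ := h.isCoveringMapOn.existsUnique_continuousMap_lifts
    ⟨hm.restrict φ unitDisk U, hφ.holo.continuousOn.mapsToRestrict hm⟩ (a₀ := ⟨a, ha⟩)
    (e₀ := ⟨x, hx⟩) (Subtype.ext hxa) (fun z => (hφ.mapsTo z.2).2)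
  let g : ℂ → ℂ := fun z => if hz : z ∈ unitDisk then F ⟨z, hz⟩ else 0
  have hg : ∀ z (hz : z ∈ unitDisk), g z = F ⟨z, hz⟩ := fun z hz => dif_pos hz
  have hgl : ∀ z ∈ unitDisk, f (g z) = φ z := fun z hz => by
    rw [hg z hz]
    exact congrArg Subtype.val (congrFun hF ⟨z, hz⟩)
  have hgU : MapsTo g unitDisk U' := fun z hz => by rw [hg z hz]; exact (F _).2
  have hgm : MapsTo g unitDisk (U' \ J) := fun z hz => ⟨hgU hz, fun hJ =>
    (hφ.mapsTo hz).2 (hgl z hz ▸ (h.mem_iff_map_mem (hgU hz)).2 hJ)⟩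
  have hgc : ContinuousOn g unitDisk := by
    rw [continuousOn_iff_continuous_domRestrict]
    have : unitDisk.domRestrict g = fun z => (F z : ℂ) := funext fun z => hg z z.2
    rw [this]
    fun_prop
  refine ⟨g, fun z hz => ?_, hgm, by rw [hg a ha, hFa], hgl⟩
  obtain ⟨V, hV, hVi⟩ := exists_nhds_injOn_of_deriv_ne_zero (h.analyticAt (hgU hz))
    (h.deriv_ne_zero _ (hgm hz).1 (hgm hz).2)
  have hD := isOpen_unitDisk.mem_nhds hz
  refine (differentiableAt_of_comp_eq (h.analyticAt (hgU hz)) hV hVi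
    (hφ.holo.analyticAt hD) ?_ ?_).differentiableWithinAt
  · filter_upwards [hD] with y hy using hgc.continuousAt (isOpen_unitDisk.mem_nhds hy)
  · filter_upwards [hD] with y hy using hgl y hy

/-- Lift twice: first `φ` through `f`, starting from each preimage of `φ 0`, then the result through
`φ`. -/
theorem exists_liftSystem (h : IsCantorSystem f U U' J) {φ : ℂ → ℂ}
    (hφ : IsDiskUniversalCover φ (U \ J)) {d : ℕ} (hd : (U' ∩ f ⁻¹' {φ 0}).ncard = d) :
    ∃ g : Fin d → ℂ → ℂ, IsLiftSystem f U' φ g := by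
  have h0 := zero_mem_unitDisk
  have hfin := h.finite_fiber (φ 0) (hφ.mapsTo h0).1
  have : Finite ↥(U' ∩ f ⁻¹' {φ 0}) := hfin
  let e : Fin d ≃ ↥(U' ∩ f ⁻¹' {φ 0}) := (Finite.equivFinOfCardEq (by simpa using hd)).symm
  have hl : ∀ j, ∃ k : ℂ → ℂ, DifferentiableOn ℂ k unitDisk ∧ MapsTo k unitDisk (U' \ J) ∧
      k 0 = e j ∧ ∀ z ∈ unitDisk, f (k z) = φ z :=
    fun j => h.exists_lift hφ h0 (e j).2.1 (e j).2.2
  choose k hkd hkm hk0 hkf using hl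
  have hg : ∀ j, ∃ g : ℂ → ℂ, DifferentiableOn ℂ g unitDisk ∧ MapsTo g unitDisk unitDisk ∧
      ∀ z ∈ unitDisk, φ (g z) = k j z := fun j => by
    have hm : MapsTo (k j) unitDisk (U \ J) :=
      fun z hz => ⟨h.domain_subset (hkm j hz).1, (hkm j hz).2⟩
    obtain ⟨b, hb, hbk⟩ := hφ.surjOn (hm h0)
    obtain ⟨g, h1, h2, -, h3⟩ := hφ.exists_lift (hkd j) hm h0 hb hbk
    exact ⟨g, h1, h2, h3⟩
  choose g hgd hgm hgk using hg
  refine ⟨g, hgd, hgm, fun j z hz => ?_, fun j z hz => ?_, ?_⟩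
  · rw [hgk j z hz]
    exact (hkm j hz).1
  · rw [hgk j z hz, hkf j z hz]
  · have : (fun j => φ (g j 0)) = fun j => (e j : ℂ) := funext fun j => by
      rw [hgk j 0 h0, hk0]
    rw [this]
    refine ⟨fun j _ => (e j).2, fun i _ j _ hij => e.injective (Subtype.ext hij), fun x hx => ?_⟩
    exact ⟨e.symm ⟨x, hx⟩, mem_univ _, by simp⟩

end IsCantorSystem

namespace IsLiftSystem

variable {f φ : ℂ → ℂ} {U U' J : Set ℂ} {d : ℕ} {g : Fin d → ℂ → ℂ}

theorem continuousOn (hg : IsLiftSystem f U' φ g) (j : Fin d) : ContinuousOn (g j) unitDisk :=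
  (hg.holo j).continuousOn

theorem mapsTo_diff (hg : IsLiftSystem f U' φ g) (hφ : IsDiskUniversalCover φ (U \ J))
    (j : Fin d) : MapsTo (fun z => φ (g j z)) unitDisk (U' \ J) := fun z hz =>
  ⟨hg.mem_domain j z hz, (hφ.mapsTo (hg.mapsTo j hz)).2⟩

theorem continuousOn_comp (hg : IsLiftSystem f U' φ g) (hφ : IsDiskUniversalCover φ (U \ J))
    (j : Fin d) : ContinuousOn (fun z => φ (g j z)) unitDisk :=
  hφ.holo.continuousOn.comp (hg.continuousOn j) (hg.mapsTo j)

/-- The maps `φ ∘ g j` are lifts of `φ` through `f`. Two that meet anywhere agree at `0`, where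
their values are distinct for distinct indices. -/
theorem eq_of_apply_eq (hg : IsLiftSystem f U' φ g) (h : IsCantorSystem f U U' J)
    (hφ : IsDiskUniversalCover φ (U \ J)) {i j : Fin d} {u : ℂ} (hu : u ∈ unitDisk)
    (hij : φ (g i u) = φ (g j u)) : i = j := by
  refine hg.base.injOn (mem_univ i) (mem_univ j) ?_
  exact h.locallyInjOn.eqOn isPreconnected_unitDisk (hg.continuousOn_comp hφ i)
    (hg.continuousOn_comp hφ j) (hg.mapsTo_diff hφ i) (hg.mapsTo_diff hφ j)
    (fun z hz => by rw [hg.lift i z hz, hg.lift j z hz]) hu hij zero_mem_unitDisk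

/-- The lift of `φ` through `f` taking the value `x` at `v` sends `0` to some preimage of `φ 0`,
hence is one of the `φ ∘ g j`. -/
theorem exists_apply_eq (hg : IsLiftSystem f U' φ g) (h : IsCantorSystem f U U' J)
    (hφ : IsDiskUniversalCover φ (U \ J)) {v x : ℂ} (hv : v ∈ unitDisk) (hx : x ∈ U')
    (hxv : f x = φ v) : ∃ j, φ (g j v) = x := by
  obtain ⟨k, hkd, hkm, hkv, hkf⟩ := h.exists_lift hφ hv hx hxv
  have h0 := zero_mem_unitDisk
  obtain ⟨j, -, hj⟩ := hg.base.surjOn ⟨(hkm h0).1, hkf 0 h0⟩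
  refine ⟨j, ?_⟩
  rw [← hkv]
  exact h.locallyInjOn.eqOn isPreconnected_unitDisk (hg.continuousOn_comp hφ j) hkd.continuousOn
    (hg.mapsTo_diff hφ j) hkm (fun z hz => by rw [hg.lift j z hz, hkf z hz]) h0 hj hv

end IsLiftSystem

/-! ### Iterated preimages. -/

/-- The points of the `k`-fold preimage of `Y` whose first `k` iterates are taken in `U'`. -/
def preimageLevel (f : ℂ → ℂ) (U' Y : Set ℂ) : ℕ → Set ℂ
  | 0 => Y
  | k + 1 => U' ∩ f ⁻¹' preimageLevel f U' Y k

theorem mapsTo_iterate_preimageLevel (f : ℂ → ℂ) (U' Y : Set ℂ) (k : ℕ) :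
    MapsTo f^[k] (preimageLevel f U' Y k) Y := by
  induction k with
  | zero => exact mapsTo_id _
  | succ k ih => exact fun x hx => ih hx.2

namespace IsCantorSystem

variable {f : ℂ → ℂ} {U U' J : Set ℂ}

theorem isOpen_preimageLevel (h : IsCantorSystem f U U' J) {Y : Set ℂ} (hY : IsOpen Y) (k : ℕ) :
    IsOpen (preimageLevel f U' Y k) := by
  induction k with
  | zero => exact hY
  | succ k ih => exact h.holo.continuousOn.isOpen_inter_preimage h.isOpen_domain ih

theorem preimageLevel_subset (h : IsCantorSystem f U U' J) (k : ℕ) :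
    preimageLevel f U' (U \ J) k ⊆ U \ J := by
  induction k with
  | zero => exact Subset.rfl
  | succ k ih => exact fun x hx =>
      ⟨h.domain_subset hx.1, fun hJ => (ih hx.2).2 ((h.mem_iff_map_mem hx.1).2 hJ)⟩

theorem preimageLevel_succ_subset (h : IsCantorSystem f U U' J) (k : ℕ) :
    preimageLevel f U' (U \ J) (k + 1) ⊆ preimageLevel f U' (U \ J) k := by
  induction k with
  | zero => exact h.preimageLevel_subset 1
  | succ k ih => exact fun x hx => ⟨hx.1, ih hx.2⟩

theorem continuousOn_iterate (h : IsCantorSystem f U U' J) (k : ℕ) :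
    ContinuousOn f^[k] (preimageLevel f U' (U \ J) k) := by
  induction k with
  | zero => exact continuousOn_id
  | succ k ih => exact ih.comp (h.holo.continuousOn.mono inter_subset_left) fun x hx => hx.2

theorem locallyInjOn_iterate (h : IsCantorSystem f U U' J) (k : ℕ) :
    LocallyInjOn f^[k] (preimageLevel f U' (U \ J) k) := by
  induction k with
  | zero => exact fun x _ => ⟨univ, univ_mem, injOn_id _⟩
  | succ k ih =>
    exact ih.comp (h.locallyInjOn.mono fun x hx => ⟨hx.1, (h.preimageLevel_subset (k + 1) hx).2⟩)
      (h.holo.continuousOn.mono inter_subset_left) fun x hx => hx.2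

/-- With `U` in place of `U \ J`, the levels are open neighbourhoods of `J`; this is where the local
non-separation of the plane by `J` is applied. -/
theorem subset_preimageLevel (h : IsCantorSystem f U U' J) (k : ℕ) :
    J ⊆ preimageLevel f U' U k := by
  induction k with
  | zero => exact h.subset_domain.trans h.domain_subset
  | succ k ih =>
    exact fun x hx => ⟨h.subset_domain hx, ih ((h.mem_iff_map_mem (h.subset_domain hx)).2 hx)⟩

theorem preimageLevel_diff_subset (h : IsCantorSystem f U U' J) (k : ℕ) :
    preimageLevel f U' U k \ J ⊆ preimageLevel f U' (U \ J) k := by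
  induction k with
  | zero => exact Subset.rfl
  | succ k ih =>
    exact fun x hx => ⟨hx.1.1, ih ⟨hx.1.2, fun hJ => hx.2 ((h.mem_iff_map_mem hx.1.1).1 hJ)⟩⟩

end IsCantorSystem

/-! ### Block images as path components; construction of good families. -/

section Blocks

variable {f φ : ℂ → ℂ} {U U' J : Set ℂ} {d : ℕ} {g : Fin d → ℂ → ℂ}

theorem blockMap_succ (k : ℕ) (e : Fin (k + 1) → Fin d) (c : Fin (k + 1) → ℂ → ℂ) (u : ℂ) :
    blockMap g (k + 1) e c u = c 0 (g (e 0) (blockMap g k (Fin.tail e) (Fin.tail c) u)) := rfl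

theorem image_blockMap_cons (k : ℕ) (e : Fin (k + 1) → Fin d) (c₀ : ℂ → ℂ) (c : Fin k → ℂ → ℂ) :
    blockMap g (k + 1) e (Fin.cons c₀ c) '' unitDisk =
      c₀ '' (g (e 0) '' (blockMap g k (Fin.tail e) c '' unitDisk)) := by
  simp only [image_image]
  rfl

theorem mapsTo_blockMap (hg : IsLiftSystem f U' φ g) {k : ℕ} (e : Fin k → Fin d)
    {c : Fin k → ℂ → ℂ} (hc : ∀ l, IsDeck φ (c l)) :
    MapsTo (blockMap g k e c) unitDisk unitDisk := by
  induction k with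
  | zero => exact mapsTo_id _
  | succ k ih =>
    exact (hc 0).mapsTo.comp ((hg.mapsTo _).comp (ih (Fin.tail e) fun l => hc l.succ))

theorem continuousOn_blockMap (hg : IsLiftSystem f U' φ g) {k : ℕ} (e : Fin k → Fin d)
    {c : Fin k → ℂ → ℂ} (hc : ∀ l, IsDeck φ (c l)) :
    ContinuousOn (blockMap g k e c) unitDisk := by
  induction k with
  | zero => exact continuousOn_id
  | succ k ih =>
    have hm := mapsTo_blockMap hg (Fin.tail e) fun l => hc (Fin.succ l)
    exact (hc 0).holo.continuousOn.comp ((hg.continuousOn _).comp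
      (ih (Fin.tail e) fun l => hc l.succ) hm) ((hg.mapsTo _).comp hm)

theorem eqOn_blockMap (hg : IsLiftSystem f U' φ g) {k : ℕ} (e : Fin k → Fin d)
    {c c' : Fin k → ℂ → ℂ} (hc : ∀ l, IsDeck φ (c l)) (h : ∀ l, EqOn (c l) (c' l) unitDisk) :
    EqOn (blockMap g k e c) (blockMap g k e c') unitDisk := by
  induction k with
  | zero => exact fun _ _ => rfl
  | succ k ih =>
    intro u hu
    rw [blockMap_succ, blockMap_succ, ← ih (Fin.tail e) (c := Fin.tail c) (c' := Fin.tail c')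
      (fun l => hc l.succ) (fun l => h l.succ) hu]
    exact h 0 (hg.mapsTo _ (mapsTo_blockMap hg _ (fun l => hc (Fin.succ l)) hu))

theorem map_blockMap_succ (hg : IsLiftSystem f U' φ g) {k : ℕ} (e : Fin (k + 1) → Fin d)
    {c : Fin (k + 1) → ℂ → ℂ} (hc : ∀ l, IsDeck φ (c l)) {u : ℂ} (hu : u ∈ unitDisk) :
    φ (blockMap g (k + 1) e c u) =
      φ (g (e 0) (blockMap g k (Fin.tail e) (Fin.tail c) u)) :=
  (hc 0).comp_eq _ (hg.mapsTo _ (mapsTo_blockMap hg _ (fun l => hc (Fin.succ l)) hu))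

theorem mapsTo_preimageLevel (hg : IsLiftSystem f U' φ g)
    (hφ : IsDiskUniversalCover φ (U \ J)) {k : ℕ} (e : Fin k → Fin d)
    {c : Fin k → ℂ → ℂ} (hc : ∀ l, IsDeck φ (c l)) :
    MapsTo (fun u => φ (blockMap g k e c u)) unitDisk (preimageLevel f U' (U \ J) k) := by
  induction k with
  | zero => exact hφ.mapsTo
  | succ k ih =>
    intro u hu
    have hm := mapsTo_blockMap hg (Fin.tail e) (c := Fin.tail c) (fun l => hc (Fin.succ l)) hu
    simp only [map_blockMap_succ hg e hc hu]
    refine ⟨hg.mem_domain _ _ hm, ?_⟩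
    rw [mem_preimage, hg.lift _ _ hm]
    exact ih (Fin.tail e) (fun l => hc l.succ) hu

theorem iterate_map_blockMap (hg : IsLiftSystem f U' φ g) {k : ℕ} (e : Fin k → Fin d)
    {c : Fin k → ℂ → ℂ} (hc : ∀ l, IsDeck φ (c l)) {u : ℂ} (hu : u ∈ unitDisk) :
    f^[k] (φ (blockMap g k e c u)) = φ u := by
  induction k with
  | zero => rfl
  | succ k ih =>
    rw [Function.iterate_succ_apply, map_blockMap_succ hg e hc hu,
      hg.lift _ _ (mapsTo_blockMap hg (Fin.tail e) (c := Fin.tail c)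
        (fun l => hc (Fin.succ l)) hu)]
    exact ih (Fin.tail e) (fun l => hc l.succ)

/-- `image_eq_pathComponentIn` applied with `F = f^[k]`. Consequently block images of the same
length are equal or disjoint, whatever the deck transformations. -/
theorem image_map_blockMap_eq (h : IsCantorSystem f U U' J) (hφ : IsDiskUniversalCover φ (U \ J))
    (hg : IsLiftSystem f U' φ g) {k : ℕ} (e : Fin k → Fin d) {c : Fin k → ℂ → ℂ}
    (hc : ∀ l, IsDeck φ (c l)) {y : ℂ} (hy : y ∈ φ '' (blockMap g k e c '' unitDisk)) :
    φ '' (blockMap g k e c '' unitDisk) = pathComponentIn (preimageLevel f U' (U \ J) k) y := by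
  rw [image_image] at hy ⊢
  exact hφ.image_eq_pathComponentIn (h.continuousOn_iterate k)
    (mapsTo_iterate_preimageLevel f U' _ k) (h.locallyInjOn_iterate k)
    (hφ.holo.continuousOn.comp (continuousOn_blockMap hg e hc) (mapsTo_blockMap hg e hc))
    (mapsTo_preimageLevel hg hφ e hc) (fun u hu => iterate_map_blockMap hg e hc hu) hy

theorem image_blockMap_eq (h : IsCantorSystem f U U' J) (hφ : IsDiskUniversalCover φ (U \ J))
    (hg : IsLiftSystem f U' φ g) {k : ℕ} (e : Fin k → Fin d) {c : Fin k → ℂ → ℂ}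
    (hc : ∀ l, IsDeck φ (c l)) {y : ℂ} (hy : y ∈ blockMap g k e c '' unitDisk) :
    blockMap g k e c '' unitDisk =
      pathComponentIn (unitDisk ∩ φ ⁻¹' preimageLevel f U' (U \ J) k) y := by
  have hφc := hφ.holo.continuousOn.mono
    (inter_subset_left (t := φ ⁻¹' preimageLevel f U' (U \ J) k))
  exact hφ.image_eq_pathComponentIn (F := f^[k] ∘ φ)
    ((h.continuousOn_iterate k).comp hφc fun x hx => hx.2)
    (fun x hx => mapsTo_iterate_preimageLevel f U' _ k hx.2)
    ((h.locallyInjOn_iterate k).comp (hφ.locallyInjOn.mono inter_subset_left) hφc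
      fun x hx => hx.2)
    (continuousOn_blockMap hg e hc)
    (fun u hu => ⟨mapsTo_blockMap hg e hc hu, mapsTo_preimageLevel hg hφ e hc hu⟩)
    (fun u hu => iterate_map_blockMap hg e hc hu) hy

/-- The properties of the deck transformations at level `k` needed to continue the construction
of a good family. -/
structure IsGoodLevel (φ : ℂ → ℂ) (g : Fin d → ℂ → ℂ) (k : ℕ)
    (Γ : (Fin k → Fin d) → Fin k → ℂ → ℂ) : Prop where
  deck : ∀ e l, IsDeck φ (Γ e l)
  merged : ∀ e e' : Fin k → Fin d, φ '' (blockMap g k e (Γ e) '' unitDisk) =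
    φ '' (blockMap g k e' (Γ e') '' unitDisk) →
      blockMap g k e (Γ e) '' unitDisk = blockMap g k e' (Γ e') '' unitDisk
  image_subset : ∀ e : Fin (k + 1) → Fin d,
    φ '' (g (e 0) '' (blockMap g k (Fin.tail e) (Γ (Fin.tail e)) '' unitDisk)) ⊆
      φ '' (blockMap g k (Fin.init e) (Γ (Fin.init e)) '' unitDisk)

theorem IsDeck.image_image_eq {γ : ℂ → ℂ} (hγ : IsDeck φ γ) {S : Set ℂ} (hS : S ⊆ unitDisk) :
    φ '' (γ '' S) = φ '' S := by
  rw [image_image]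
  exact image_congr fun z hz => hγ.comp_eq z (hS hz)

/-- The shift condition forces all deck transformations but the outermost, and that one does not
affect the image `A e` downstairs. It is chosen so that the new set passes through a base point in
`V (Fin.init e)` lying over `A e`. Since the base point depends only on the set `A e`, equal images
give the same component upstairs (merging); since it lies in the component `V (Fin.init e)` of the
larger level, nesting follows. -/
theorem IsGoodLevel.exists_succ (h : IsCantorSystem f U U' J)
    (hφ : IsDiskUniversalCover φ (U \ J)) (hg : IsLiftSystem f U' φ g) {k : ℕ}
    {Γ : (Fin k → Fin d) → Fin k → ℂ → ℂ} (hΓ : IsGoodLevel φ g k Γ) :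
    ∃ Γ' : (Fin (k + 1) → Fin d) → Fin (k + 1) → ℂ → ℂ, IsGoodLevel φ g (k + 1) Γ' ∧
      (∀ e, blockMap g (k + 1) e (Γ' e) '' unitDisk ⊆
        blockMap g k (Fin.init e) (Γ (Fin.init e)) '' unitDisk) ∧
      ∀ e l, Γ' e (Fin.succ l) = Γ (Fin.tail e) l := by
  classical
  set V : (Fin k → Fin d) → Set ℂ := fun e => blockMap g k e (Γ e) '' unitDisk with hV
  set A : (Fin (k + 1) → Fin d) → Set ℂ := fun e => φ '' (g (e 0) '' V (Fin.tail e)) with hA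
  have hVD : ∀ e, V e ⊆ unitDisk := fun e => (mapsTo_blockMap hg e (hΓ.deck e)).image_subset
  have hgV : ∀ e : Fin (k + 1) → Fin d, g (e 0) '' V (Fin.tail e) ⊆ unitDisk := fun e =>
    ((hg.mapsTo _).mono_left (hVD _)).image_subset
  have hAne : ∀ e, (A e).Nonempty := fun e =>
    (((nonempty_of_mem zero_mem_unitDisk).image _).image _).image _
  have hp : ∀ e, ∃ p ∈ V (Fin.init e), φ p ∈ A e := fun e => by
    obtain ⟨a, ha⟩ := hAne e
    obtain ⟨p, hp, rfl⟩ := hΓ.image_subset e ha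
    exact ⟨p, hp, ha⟩
  choose p hpV hpA using hp
  -- Both images at level `k` contain a common point of `A e`, so they are the same path component,
  -- and merging at level `k` applies.
  have hVinit : ∀ e e', A e = A e' → V (Fin.init e) = V (Fin.init e') := fun e e' hee => by
    refine hΓ.merged _ _ ?_
    rw [image_map_blockMap_eq h hφ hg _ (hΓ.deck _) (hΓ.image_subset e (hpA e)),
      image_map_blockMap_eq h hφ hg _ (hΓ.deck _) (hΓ.image_subset e' (hee ▸ hpA e))]
  have hP : ∃ P : Set ℂ → ℂ, ∀ e, P (A e) ∈ V (Fin.init e) ∧ φ (P (A e)) ∈ A e := by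
    -- The base point is indexed by sets rather than blocks; the value `0` on sets that are not some
    -- `A e` plays no role.
    refine ⟨fun S => if hS : ∃ e, A e = S then p hS.choose else 0, fun e => ?_⟩
    have hS : ∃ e', A e' = A e := ⟨e, rfl⟩
    simp only [dif_pos hS]
    have hc := hS.choose_spec
    rw [← hVinit _ _ hc]
    nth_rw 3 [← hc]
    exact ⟨hpV _, hpA _⟩
  obtain ⟨P, hP⟩ := hP
  have hdeck : ∀ e, ∃ γ, IsDeck φ γ ∧ P (A e) ∈ γ '' (g (e 0) '' V (Fin.tail e)) := fun e => by
    obtain ⟨q, hq, hqP⟩ := (hP e).2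
    obtain ⟨γ, hγ, hγq⟩ := hφ.exists_deck (hVD _ (hP e).1) (hgV e hq) hqP.symm
    exact ⟨γ, hγ, q, hq, hγq⟩
  choose γ hγ hγP using hdeck
  let Γ' : (Fin (k + 1) → Fin d) → Fin (k + 1) → ℂ → ℂ :=
    fun e => Fin.cons (γ e) (Γ (Fin.tail e))
  have hΓ'd : ∀ e l, IsDeck φ (Γ' e l) := fun e l => by
    refine Fin.cases ?_ (fun l => ?_) l
    · exact hγ e
    · exact hΓ.deck _ l
  have hΓ'V : ∀ e, blockMap g (k + 1) e (Γ' e) '' unitDisk =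
      γ e '' (g (e 0) '' V (Fin.tail e)) := fun e => image_blockMap_cons k e _ _
  have hΓ'P : ∀ e, blockMap g (k + 1) e (Γ' e) '' unitDisk =
      pathComponentIn (unitDisk ∩ φ ⁻¹' preimageLevel f U' (U \ J) (k + 1)) (P (A e)) := fun e =>
    image_blockMap_eq h hφ hg e (hΓ'd e) (hΓ'V e ▸ hγP e)
  have hΓ'A : ∀ e, φ '' (blockMap g (k + 1) e (Γ' e) '' unitDisk) = A e := fun e => by
    rw [hΓ'V, (hγ e).image_image_eq (hgV e)]
  have hsub : ∀ e, blockMap g (k + 1) e (Γ' e) '' unitDisk ⊆ V (Fin.init e) := fun e => by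
    rw [hΓ'P, hV]
    simp only [image_blockMap_eq h hφ hg (Fin.init e) (hΓ.deck _) (hP e).1]
    exact pathComponentIn_mono fun x hx => ⟨hx.1, h.preimageLevel_succ_subset k hx.2⟩
  refine ⟨Γ', ⟨hΓ'd, fun e e' hee => ?_, fun e => ?_⟩, hsub, fun e l => rfl⟩
  · rw [hΓ'A, hΓ'A] at hee
    rw [hΓ'P, hΓ'P, hee]
  -- The next inclusion of images follows from the nesting just proved for the tail block, because
  -- forgetting the first and the last symbol commute.
  · rw [hΓ'A (Fin.init e)]
    refine image_mono (image_mono ((hsub _).trans ?_))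
    rw [Fin.tail_init_eq_init_tail]

theorem exists_isGoodFamily (h : IsCantorSystem f U U' J)
    (hφ : IsDiskUniversalCover φ (U \ J)) (hg : IsLiftSystem f U' φ g) :
    ∃ γ : (k : ℕ) → (Fin k → Fin d) → Fin k → ℂ → ℂ, IsGoodFamily φ g γ := by
  -- For the empty block the set upstairs is the whole disk, so the inclusion of images only says
  -- that each `g j` preserves the disk.
  have h0 : IsGoodLevel φ g 0 (fun _ l => l.elim0) :=
    ⟨fun _ l => l.elim0, fun _ _ _ => rfl, fun e => by
      refine image_mono ?_
      simp only [blockMap, image_id]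
      exact (hg.mapsTo _).image_subset⟩
  choose! S hS using fun (k : ℕ) (Γ : (Fin k → Fin d) → Fin k → ℂ → ℂ)
    (hΓ : IsGoodLevel φ g k Γ) => hΓ.exists_succ h hφ hg
  let γ : (k : ℕ) → (Fin k → Fin d) → Fin k → ℂ → ℂ :=
    fun k => Nat.rec (motive := fun k => (Fin k → Fin d) → Fin k → ℂ → ℂ) (fun _ l => l.elim0) S k
  have hγ : ∀ k, IsGoodLevel φ g k (γ k) := fun k => by
    induction k with
    | zero => exact h0
    | succ k ih => exact (hS k _ ih).1
  exact ⟨γ, fun k => (hγ k).deck, fun k _ => (hS k _ (hγ k)).2.1,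
    fun k _ e l => by
      have : γ (k + 1) e l.succ = γ k (Fin.tail e) l := (hS k _ (hγ k)).2.2 e l
      exact this ▸ eqOn_refl _ _,
    fun k _ => (hγ k).merged⟩

end Blocks

/-! ### The coding map: existence, surjectivity, uniqueness of codes. -/

namespace IsGoodFamily

variable {f φ : ℂ → ℂ} {U U' J : Set ℂ} {d : ℕ} {g : Fin d → ℂ → ℂ}
  {γ : (k : ℕ) → (Fin k → Fin d) → Fin k → ℂ → ℂ}

theorem blockSet_subset (hγ : IsGoodFamily φ g γ) (hg : IsLiftSystem f U' φ g) {k : ℕ}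
    (e : Fin k → Fin d) : blockSet g γ k e ⊆ unitDisk :=
  (mapsTo_blockMap hg e (hγ.deck k e)).image_subset

theorem blockSet_nonempty (γ : (k : ℕ) → (Fin k → Fin d) → Fin k → ℂ → ℂ) (k : ℕ)
    (e : Fin k → Fin d) : (blockSet g γ k e).Nonempty :=
  (nonempty_of_mem zero_mem_unitDisk).image _

theorem map_blockMap (hγ : IsGoodFamily φ g γ) (hg : IsLiftSystem f U' φ g) {k : ℕ}
    (e : Fin (k + 1) → Fin d) {u : ℂ} (hu : u ∈ unitDisk) :
    φ (blockMap g (k + 1) e (γ (k + 1) e) u) =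
      φ (g (e 0) (blockMap g k (Fin.tail e) (γ k (Fin.tail e)) u)) := by
  rw [map_blockMap_succ hg e (hγ.deck _ e) hu,
    eqOn_blockMap hg (Fin.tail e) (c := Fin.tail (γ (k + 1) e)) (c' := γ k (Fin.tail e))
      (fun l => hγ.deck _ e l.succ) (fun l => ?_) hu]
  exact hγ.shift k (Nat.one_le_iff_ne_zero.2 fun h => (Fin.cast h l).elim0) e l

theorem image_blockSet_succ (hγ : IsGoodFamily φ g γ) (hg : IsLiftSystem f U' φ g) {k : ℕ}
    (e : Fin (k + 1) → Fin d) :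
    φ '' blockSet g γ (k + 1) e = φ '' (g (e 0) '' blockSet g γ k (Fin.tail e)) := by
  simp only [blockSet, image_image]
  exact image_congr fun u hu => hγ.map_blockMap hg e hu

theorem image_image_blockSet (hγ : IsGoodFamily φ g γ) (hg : IsLiftSystem f U' φ g) {k : ℕ}
    (e : Fin (k + 1) → Fin d) :
    f '' (φ '' blockSet g γ (k + 1) e) = φ '' blockSet g γ k (Fin.tail e) := by
  rw [hγ.image_blockSet_succ hg, image_image, image_image]
  exact image_congr fun u hu => hg.lift _ u (hγ.blockSet_subset hg _ hu)

theorem image_blockSet_subset (hγ : IsGoodFamily φ g γ) (hg : IsLiftSystem f U' φ g) {k : ℕ}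
    (e : Fin (k + 1) → Fin d) : φ '' blockSet g γ (k + 1) e ⊆ U' := by
  rw [hγ.image_blockSet_succ hg, image_image]
  rintro _ ⟨u, hu, rfl⟩
  exact hg.mem_domain _ u (hγ.blockSet_subset hg _ hu)

/-- With at least two symbols, `f` sends the block image into `U'` again, so the image lies in the
preimage of the compact set `closure U'`. By properness this preimage is a compact subset of `U'`,
so closures cannot reach the boundary of `U'`. -/
theorem closure_image_blockSet_subset (hγ : IsGoodFamily φ g γ) (hg : IsLiftSystem f U' φ g)
    (h : IsCantorSystem f U U' J) {k : ℕ} (e : Fin (k + 2) → Fin d) :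
    closure (φ '' blockSet g γ (k + 2) e) ⊆
      U' ∩ f ⁻¹' closure (φ '' blockSet g γ (k + 1) (Fin.tail e)) := by
  have hK : IsCompact (Subtype.val '' (h.mapsTo.restrict f U' U ⁻¹'
      (Subtype.val ⁻¹' closure U')) : Set ℂ) := by
    refine (h.proper.isCompact_preimage ?_).image continuous_subtype_val
    exact Topology.IsInducing.subtypeVal.isCompact_preimage' h.compact_closure
      (by simpa using h.closure_subset)
  have hsub : closure (φ '' blockSet g γ (k + 2) e) ⊆ U' := by
    refine (closure_minimal (fun x hx => ?_) hK.isClosed).trans (Subtype.coe_image_subset _ _)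
    have hxU := hγ.image_blockSet_subset hg e hx
    refine ⟨⟨x, hxU⟩, subset_closure (hγ.image_blockSet_subset hg (Fin.tail e) ?_), rfl⟩
    rw [← hγ.image_image_blockSet hg]
    exact mem_image_of_mem f hx
  refine fun x hx => ⟨hsub hx, ?_⟩
  rw [mem_preimage, ← hγ.image_image_blockSet hg]
  exact (h.analyticAt (hsub hx)).continuousAt.continuousWithinAt.mem_closure_image hx

theorem map_mem_codingSet (hγ : IsGoodFamily φ g γ) (hg : IsLiftSystem f U' φ g)
    (h : IsCantorSystem f U U' J) {ε : ℕ → Fin d} {x : ℂ} (hx : x ∈ codingSet φ g γ ε) :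
    x ∈ U' ∧ f x ∈ codingSet φ g γ fun n => ε (n + 1) := by
  simp only [codingSet, mem_iInter] at hx ⊢
  refine ⟨(hγ.closure_image_blockSet_subset hg h (k := 0) _ (hx 2 (by norm_num))).1,
    fun k hk => ?_⟩
  obtain ⟨k, rfl⟩ := Nat.exists_eq_succ_of_ne_zero (Nat.one_le_iff_ne_zero.1 hk)
  exact (hγ.closure_image_blockSet_subset hg h (k := k) _ (hx (k + 2) (by omega))).2

theorem codingSet_subset (hγ : IsGoodFamily φ g γ) (hg : IsLiftSystem f U' φ g)
    (h : IsCantorSystem f U U' J) (ε : ℕ → Fin d) : codingSet φ g γ ε ⊆ J := by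
  intro x hx
  rw [h.mem_iff]
  intro n
  induction n generalizing x ε with
  | zero => exact (hγ.map_mem_codingSet hg h hx).1
  | succ n ih => exact ih _ (hγ.map_mem_codingSet hg h hx).2

theorem antitone_image_blockSet (hγ : IsGoodFamily φ g γ) (ε : ℕ → Fin d) :
    Antitone fun k : ℕ => φ '' blockSet g γ (k + 1) (fun i => ε i) :=
  antitone_nat_of_succ_le fun k => image_mono (hγ.nested (k + 1) (by omega) _)

theorem codingSet_eq_iInter (ε : ℕ → Fin d) :
    codingSet φ g γ ε = ⋂ k : ℕ, closure (φ '' blockSet g γ (k + 1) (fun i => ε i)) := by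
  ext x
  simp only [codingSet, mem_iInter]
  refine ⟨fun hx k => hx (k + 1) (by omega), fun hx k hk => ?_⟩
  obtain ⟨k, rfl⟩ := Nat.exists_eq_succ_of_ne_zero (Nat.one_le_iff_ne_zero.1 hk)
  exact hx k

theorem antitone_closure_image_blockSet (hγ : IsGoodFamily φ g γ) (ε : ℕ → Fin d) :
    Antitone fun k : ℕ => closure (φ '' blockSet g γ (k + 1) (fun i => ε i)) :=
  fun _ _ hkl => closure_mono (hγ.antitone_image_blockSet ε hkl)

theorem isCompact_closure_image_blockSet (hγ : IsGoodFamily φ g γ)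
    (hg : IsLiftSystem f U' φ g) (h : IsCantorSystem f U U' J) {k : ℕ}
    (e : Fin (k + 1) → Fin d) : IsCompact (closure (φ '' blockSet g γ (k + 1) e)) :=
  h.compact_closure.of_isClosed_subset isClosed_closure
    (closure_mono (hγ.image_blockSet_subset hg e))

theorem isPathConnected_image_blockSet (hγ : IsGoodFamily φ g γ)
    (hφ : IsDiskUniversalCover φ (U \ J)) (hg : IsLiftSystem f U' φ g) {k : ℕ}
    (e : Fin k → Fin d) : IsPathConnected (φ '' blockSet g γ k e) :=
  (isPathConnected_unitDisk.image' (continuousOn_blockMap hg e (hγ.deck k e))).image'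
    (hφ.holo.continuousOn.mono (hγ.blockSet_subset hg e))

/-- A decreasing intersection of nonempty compact connected sets is nonempty and connected, and a
connected subset of the totally disconnected `J` has at most one point. -/
theorem exists_codingSet_eq_singleton (hγ : IsGoodFamily φ g γ)
    (hφ : IsDiskUniversalCover φ (U \ J)) (hg : IsLiftSystem f U' φ g)
    (h : IsCantorSystem f U U' J) (ε : ℕ → Fin d) :
    ∃ z : J, codingSet φ g γ ε = {(z : ℂ)} := by
  have hK := hγ.antitone_closure_image_blockSet ε
  have hc := fun k : ℕ => hγ.isCompact_closure_image_blockSet hg h (k := k) fun i => ε i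
  have hpre : IsPreconnected (codingSet φ g γ ε) := by
    rw [codingSet_eq_iInter]
    exact isPreconnected_iInter_of_antitone hK hc fun k =>
      (hγ.isPathConnected_image_blockSet hφ hg _).isConnected.isPreconnected.closure
  have hne : (codingSet φ g γ ε).Nonempty := by
    rw [codingSet_eq_iInter]
    exact IsCompact.nonempty_iInter_of_sequence_nonempty_isCompact_isClosed _
      (fun k => hK k.le_succ) (fun k => ((blockSet_nonempty γ _ _).image φ).closure) (hc 0)
      fun k => isClosed_closure
  obtain ⟨z, hz⟩ := hne
  have hsub := hγ.codingSet_subset hg h ε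
  refine ⟨⟨z, hsub hz⟩, Subset.antisymm (fun y hy => ?_) (singleton_subset_iff.2 hz)⟩
  exact (totallyDisconnectedSpace_subtype_iff.1 h.totallyDisconnected) _ hsub hpre hy hz

theorem exists_mem_image_blockSet (hγ : IsGoodFamily φ g γ)
    (hφ : IsDiskUniversalCover φ (U \ J)) (hg : IsLiftSystem f U' φ g)
    (h : IsCantorSystem f U U' J) {k : ℕ} {v : ℂ} (hv : v ∈ unitDisk) {x : ℂ}
    (hx : x ∈ preimageLevel f U' (U \ J) k) (hxv : f^[k] x = φ v) :
    ∃ e, φ (blockMap g k e (γ k e) v) = x := by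
  induction k generalizing x with
  | zero => exact ⟨Fin.elim0, hxv.symm⟩
  | succ k ih =>
    obtain ⟨e, he⟩ := ih hx.2 hxv
    obtain ⟨j, hj⟩ := hg.exists_apply_eq h hφ (mapsTo_blockMap hg e (hγ.deck k e) hv) hx.1
      he.symm
    refine ⟨Fin.cons j e, ?_⟩
    rw [hγ.map_blockMap hg _ hv]
    simpa using hj

/-- Since `J` has empty interior, `z` is a limit of points of the level outside `J`. These are
covered by the block images, and there are finitely many blocks of length `k`. -/
theorem exists_mem_closure_image_blockSet (hγ : IsGoodFamily φ g γ)
    (hφ : IsDiskUniversalCover φ (U \ J)) (hg : IsLiftSystem f U' φ g)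
    (h : IsCantorSystem f U U' J) {z : ℂ} (hz : z ∈ J) (k : ℕ) :
    ∃ e, z ∈ closure (φ '' blockSet g γ k e) := by
  have hsub : preimageLevel f U' U k \ J ⊆ ⋃ e, φ '' blockSet g γ k e := fun x hx => by
    have hx' := h.preimageLevel_diff_subset k hx
    obtain ⟨v, hv, hvx⟩ := hφ.surjOn (mapsTo_iterate_preimageLevel f U' _ k hx')
    obtain ⟨e, he⟩ := hγ.exists_mem_image_blockSet hφ hg h hv hx' hvx.symm
    exact mem_iUnion.2 ⟨e, _, mem_image_of_mem _ hv, he⟩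
  have hzc : z ∈ closure (preimageLevel f U' U k \ J) := by
    have hd : Dense Jᶜ := interior_eq_empty_iff_dense_compl.1 h.interior_eq
    exact hd.open_subset_closure_inter (h.isOpen_preimageLevel h.isOpen_range k)
      (h.subset_preimageLevel k hz)
  have := closure_mono hsub hzc
  rw [closure_iUnion_of_finite] at this
  exact mem_iUnion.1 this

theorem exists_mem_codingSet (hγ : IsGoodFamily φ g γ)
    (hφ : IsDiskUniversalCover φ (U \ J)) (hg : IsLiftSystem f U' φ g)
    (h : IsCantorSystem f U U' J) {z : ℂ} (hz : z ∈ J) : ∃ ε, z ∈ codingSet φ g γ ε := by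
  let S : ℕ → Set (ℕ → Fin d) :=
    fun k => {ε | z ∈ closure (φ '' blockSet g γ (k + 1) fun i => ε i)}
  have hScl : ∀ k, IsClosed (S k) := fun k =>
    (isClosed_discrete
      {e : Fin (k + 1) → Fin d | z ∈ closure (φ '' blockSet g γ (k + 1) e)}).preimage
      (by fun_prop : Continuous fun (ε : ℕ → Fin d) (i : Fin (k + 1)) => ε i)
  have hSne : ∀ k, (S k).Nonempty := fun k => by
    obtain ⟨e, he⟩ := hγ.exists_mem_closure_image_blockSet hφ hg h hz (k + 1)
    -- Any extension of the block to a sequence works; the filler `e 0` is arbitrary.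
    refine ⟨fun n => if hn : n < k + 1 then e ⟨n, hn⟩ else e 0, ?_⟩
    have : (fun i : Fin (k + 1) => if hn : (i : ℕ) < k + 1 then e ⟨i, hn⟩ else e 0) = e :=
      funext fun i => dif_pos i.2
    simpa only [S, mem_ofPred_eq, this] using he
  obtain ⟨ε, hε⟩ := IsCompact.nonempty_iInter_of_sequence_nonempty_isCompact_isClosed S
    (fun k ε hε => hγ.antitone_closure_image_blockSet ε k.le_succ hε) hSne (hScl 0).isCompact hScl
  refine ⟨ε, ?_⟩
  rw [codingSet_eq_iInter]
  exact mem_iInter.2 fun k => mem_iInter.1 hε k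

/-- Both images contain points arbitrarily near `z`, and such points can be joined inside the level
off `J`, since `J` does not separate the plane locally. Hence both are the same path component. -/
theorem image_blockSet_eq_of_mem_closure (hγ : IsGoodFamily φ g γ)
    (hφ : IsDiskUniversalCover φ (U \ J)) (hg : IsLiftSystem f U' φ g)
    (h : IsCantorSystem f U U' J) {z : ℂ} (hz : z ∈ J) {k : ℕ} {e e' : Fin k → Fin d}
    (he : z ∈ closure (φ '' blockSet g γ k e)) (he' : z ∈ closure (φ '' blockSet g γ k e')) :
    φ '' blockSet g γ k e = φ '' blockSet g γ k e' := by
  obtain ⟨W, hW, hWj⟩ := exists_nhds_forall_joinedIn_diff h.compact h.totallyDisconnected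
    hφ.isPreconnected h.isOpen_range (h.subset_domain.trans h.domain_subset)
    (h.isOpen_preimageLevel h.isOpen_range k) hz (h.subset_preimageLevel k hz)
  obtain ⟨p, hpW, hp⟩ := mem_closure_iff_nhds.1 he W hW
  obtain ⟨q, hqW, hq⟩ := mem_closure_iff_nhds.1 he' W hW
  have hpe := image_map_blockMap_eq h hφ hg e (hγ.deck k e) hp
  have hqe := image_map_blockMap_eq h hφ hg e' (hγ.deck k e') hq
  have hnot : ∀ {e : Fin k → Fin d} {x}, x ∈ φ '' blockSet g γ k e → x ∉ J := by
    rintro e _ ⟨u, hu, rfl⟩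
    exact (hφ.mapsTo (hγ.blockSet_subset hg e hu)).2
  have hj := (hWj q ⟨hqW, hnot hq⟩ p ⟨hpW, hnot hp⟩).mono (h.preimageLevel_diff_subset k)
  exact hpe.trans ((pathComponentIn_congr hj).trans hqe.symm)

theorem head_eq_of_mem_codingSet (hγ : IsGoodFamily φ g γ)
    (hφ : IsDiskUniversalCover φ (U \ J)) (hg : IsLiftSystem f U' φ g)
    (h : IsCantorSystem f U U' J) {z : ℂ} (hz : deriv f z ≠ 0) {ε ε' : ℕ → Fin d}
    (hε : z ∈ codingSet φ g γ ε) (hε' : z ∈ codingSet φ g γ ε') : ε 0 = ε' 0 := by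
  have hzJ : z ∈ J := hγ.codingSet_subset hg h ε hε
  obtain ⟨W, hW, hWi⟩ :=
    exists_nhds_injOn_of_deriv_ne_zero (h.analyticAt (h.subset_domain hzJ)) hz
  obtain ⟨y, hy⟩ := hγ.exists_codingSet_eq_singleton hφ hg h ε
  have hyz : z = y := by simpa [hy] using hε
  obtain ⟨k, hk⟩ := exists_subset_nhds_of_isCompact
    (hγ.antitone_closure_image_blockSet ε).directed_ge
    (fun k => hγ.isCompact_closure_image_blockSet hg h fun i => ε i) (U := W) (fun x hx => by
      rw [← codingSet_eq_iInter, hy, ← hyz] at hx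
      rwa [mem_singleton_iff.1 hx])
  rw [codingSet_eq_iInter, mem_iInter] at hε hε'
  -- Length `k + 2` keeps the tail nonempty, as merging requires blocks of length at least one.
  have hkW : φ '' blockSet g γ (k + 2) (fun i => ε i) ⊆ W :=
    (hγ.antitone_image_blockSet ε k.le_succ).trans (subset_closure.trans hk)
  have heq := hγ.image_blockSet_eq_of_mem_closure hφ hg h hzJ (hε (k + 1)) (hε' (k + 1))
  -- Applying `f` to the equal images shows that the tails have equal images downstairs; merging
  -- lifts this to an equality in the disk. A single `u` then serves both sequences, and `φ (g (ε 0)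
  -- u)`, `φ (g (ε' 0) u)` are two points of `W` with the same image `φ u` under `f`.
  have htail := hγ.merged (k + 1) (by omega)
    (Fin.tail fun i : Fin (k + 2) => ε i) (Fin.tail fun i : Fin (k + 2) => ε' i)
    (by rw [← hγ.image_image_blockSet hg, heq, hγ.image_image_blockSet hg])
  obtain ⟨u, hu⟩ := blockSet_nonempty (g := g) γ (k + 1) (Fin.tail fun i : Fin (k + 2) => ε i)
  have hu' : u ∈ blockSet g γ (k + 1) (Fin.tail fun i : Fin (k + 2) => ε' i) := by
    rwa [← htail]
  have hm : φ (g (ε 0) u) ∈ φ '' blockSet g γ (k + 2) (fun i => ε i) := by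
    rw [hγ.image_blockSet_succ hg]
    exact ⟨_, ⟨u, hu, rfl⟩, rfl⟩
  have hm' : φ (g (ε' 0) u) ∈ φ '' blockSet g γ (k + 2) (fun i => ε i) := by
    rw [heq, hγ.image_blockSet_succ hg]
    exact ⟨_, ⟨u, hu', rfl⟩, rfl⟩
  have huD := hγ.blockSet_subset hg _ hu
  refine hg.eq_of_apply_eq h hφ huD (hWi (hkW hm) (hkW hm') ?_)
  rw [hg.lift _ u huD, hg.lift _ u huD]

theorem eq_of_mem_codingSet (hγ : IsGoodFamily φ g γ)
    (hφ : IsDiskUniversalCover φ (U \ J)) (hg : IsLiftSystem f U' φ g)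
    (h : IsCantorSystem f U U' J) {z : ℂ} (hz : ∀ n : ℕ, deriv f (f^[n] z) ≠ 0)
    {ε ε' : ℕ → Fin d} (hε : z ∈ codingSet φ g γ ε) (hε' : z ∈ codingSet φ g γ ε') : ε = ε' := by
  funext n
  induction n generalizing z ε ε' with
  | zero => exact hγ.head_eq_of_mem_codingSet hφ hg h (hz 0) hε hε'
  | succ n ih =>
    exact ih (fun m => hz (m + 1)) (hγ.map_mem_codingSet hg h hε).2
      (hγ.map_mem_codingSet hg h hε').2

end IsGoodFamily

/-! ### From generalized polynomial-like maps to the topological data. -/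

namespace IsGenPolyLike

variable {f : ℂ → ℂ} {U U' : Set ℂ} {N : ℕ} {D : Fin N → Set ℂ}

theorem isOpen_domain (hf : IsGenPolyLike f U U' D) : IsOpen U' := by
  rw [hf.union]
  exact isOpen_iUnion fun i => (hf.disk_component i).1

theorem fiber_eq (hf : IsGenPolyLike f U U' D) (v : ℂ) :
    U' ∩ f ⁻¹' {v} = ⋃ i, D i ∩ f ⁻¹' {v} := by
  rw [hf.union, iUnion_inter]

theorem isCantorSystem (hf : IsGenPolyLike f U U' D) {δ : Fin N → ℕ}
    (hδ : ∀ i, HasDegree f (D i) U (δ i)) (hKJ : filledJulia f U' = julia f U')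
    (hCantor : IsCantorSet (julia f U')) (hcrit : ∀ c ∈ U', deriv f c = 0 → c ∈ julia f U') :
    IsCantorSystem f U U' (julia f U') := by
  obtain ⟨e⟩ := hCantor
  have hcomp : IsCompact (julia f U') :=
    isCompact_iff_compactSpace.2 e.symm.compactSpace
  exact
    { isOpen_range := hf.disk.1
      isOpen_domain := hf.isOpen_domain
      compact_closure := hf.compact_closure
      closure_subset := hf.closure_subset
      holo := hf.holo
      mapsTo := hf.mapsTo
      proper := hf.proper
      finite_fiber := fun v hv => by
        rw [hf.fiber_eq]
        exact finite_iUnion fun i => (hδ i v hv).1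
      mem_iff := fun z => by rw [← hKJ]; rfl
      compact := hcomp
      totallyDisconnected := ⟨isTotallyDisconnected_of_image e.continuous.continuousOn
        e.injective (isTotallyDisconnected_of_totallyDisconnectedSpace _)⟩
      -- `J` is the frontier of the filled-in set, which is closed because it equals the compact set
      -- `J`; the frontier of a closed set has empty interior.
      interior_eq := by
        have : IsClosed (filledJulia f U') := hKJ ▸ hcomp.isClosed
        exact interior_frontier this
      deriv_ne_zero := fun x hx hxJ h0 => hxJ (hcrit x hx h0) }

/-- Over a regular value every local multiplicity is one, so the degree of each component counts
points. -/
theorem ncard_fiber (hf : IsGenPolyLike f U U' D) {δ : Fin N → ℕ}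
    (hδ : ∀ i, HasDegree f (D i) U (δ i)) {v : ℂ} (hv : v ∈ U)
    (hreg : ∀ x ∈ U', f x = v → deriv f x ≠ 0) : (U' ∩ f ⁻¹' {v}).ncard = ∑ i, δ i := by
  have hcard : ∀ i, (D i ∩ f ⁻¹' {v}).ncard = δ i := fun i => by
    rw [← (hδ i v hv).2, ← finsum_one]
    refine finsum_mem_congr rfl fun x hx => ?_
    have hxU : x ∈ U' := hf.union ▸ mem_iUnion.2 ⟨i, hx.1⟩
    have hxv : f x = v := hx.2
    have hfx := hf.holo.analyticAt (hf.isOpen_domain.mem_nhds hxU)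
    have := hfx.analyticOrderAt_sub_eq_one_of_deriv_ne_zero (hreg x hxU hxv)
    rw [hxv] at this
    simp [analyticOrderNatAt, this]
  rw [hf.fiber_eq, ncard_iUnion_of_finite (fun i => (hδ i v hv).1) fun i j hij =>
    (hf.disjoint i j hij).mono inter_subset_left inter_subset_left, finsum_eq_sum_of_fintype]
  exact Finset.sum_congr rfl fun i _ => hcard i

end IsGenPolyLike

theorem mainTheorem4 (f : ℂ → ℂ) (U U' : Set ℂ) {N : ℕ} (D : Fin N → Set ℂ)
    (hf : IsGenPolyLike f U U' D)
    (δ : Fin N → ℕ) (hδ : ∀ i, HasDegree f (D i) U (δ i))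
    (d : ℕ) (hd : d = ∑ i, δ i) (hd1 : 1 < d)
    (hKJ : filledJulia f U' = julia f U')
    (hCantor : IsCantorSet (julia f U'))
    (hcrit : ∀ c ∈ U', deriv f c = 0 → c ∈ julia f U')
    (w : ℂ) (hw : w ∈ U \ U')
    (φ : ℂ → ℂ) (hφ : IsDiskUniversalCover φ (U \ julia f U')) (hφw : φ 0 = w) :
    (∃ g : Fin d → ℂ → ℂ, IsLiftSystem f U' φ g) ∧
    ∀ g : Fin d → ℂ → ℂ, IsLiftSystem f U' φ g →
      (∃ γ : (k : ℕ) → (Fin k → Fin d) → Fin k → ℂ → ℂ, IsGoodFamily φ g γ) ∧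
      ∀ γ : (k : ℕ) → (Fin k → Fin d) → Fin k → ℂ → ℂ, IsGoodFamily φ g γ →
        ∃ π : (ℕ → Fin d) → julia f U',
          (∀ ε, codingSet φ g γ ε = {(π ε : ℂ)}) ∧
          ∀ z : julia f U', (∀ n : ℕ, deriv f (f^[n] z) ≠ 0) →
            (π ⁻¹' {z}).encard = 1 := by
  have h := hf.isCantorSystem hδ hKJ hCantor hcrit
  have h0 := hφ.mapsTo zero_mem_unitDisk
  refine ⟨h.exists_liftSystem hφ ?_, fun g hg => ⟨exists_isGoodFamily h hφ hg, fun γ hγ => ?_⟩⟩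
  · rw [hd]
    -- The base point is a regular value: a critical preimage would lie in `J`, and invariance would
    -- put `φ 0` in `J`.
    refine hf.ncard_fiber hδ h0.1 fun x hx hxv => h.deriv_ne_zero x hx fun hxJ => h0.2 ?_
    rw [← hxv]
    exact (h.mem_iff_map_mem hx).2 hxJ
  · choose π hπ using hγ.exists_codingSet_eq_singleton hφ hg h
    have hmem : ∀ (ε : ℕ → Fin d) (z : julia f U'), π ε = z ↔ (z : ℂ) ∈ codingSet φ g γ ε :=
      fun ε z => by rw [hπ ε, mem_singleton_iff, Subtype.ext_iff, eq_comm]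
    refine ⟨π, hπ, fun z hz => encard_eq_one.2 ?_⟩
    obtain ⟨ε, hε⟩ := hγ.exists_mem_codingSet hφ hg h z.2
    refine ⟨ε, eq_singleton_iff_unique_mem.2 ⟨(hmem ε z).2 hε, fun ε' hε' => ?_⟩⟩
    exact hγ.eq_of_mem_codingSet hφ hg h hz ((hmem ε' z).1 hε') hε
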